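/- Let $G$ be a locally compact (Hausdorff) group with a fixed left Haar measure, and write $(L_xf)(y)=f(x^{-1}y)$. Let $S^1(G)$ be a Segal algebra in $L^1(G)$, i.e. a dense subspace of $L^1(G)$ which is a left ideal for convolution, is closed under all left translations $L_x$ $(x\in G)$, and carries a complete norm $\|\cdot\|_S$ for which it is a Banach algebra, the inclusion $S^1(G)\hookrightarrow L^1(G)$ is continuous, $\|f*b\|_S\le\|f\|_1\|b\|_S$ for all $f\in L^1(G)$ and $b\in S^1(G)$, and the linear span of $L^1(G)*S^1(G)$ is $\|\cdot\|_S$-dense in $S^1(G)$. Suppose that $S^1(G)$ is pseudo-amenable, i.e. that there is a (not necessarily bounded) net $(m_\gamma)$ in the projective tensor product $S^1(G)\widehat{\otimes}S^1(G)$ such that $a\cdot m_\gamma-m_\gamma\cdot a\to 0$ and $\pi(m_\gamma)a\to a$ in norm for every $a\in S^1(G)$, where $a\cdot(b\otimes c)=(ab)\otimes c$, $(b\otimes c)\cdot a=b\otimes(ca)$ and $\pi(b\otimes c)=bc$. Then $G$ is amenable, i.e. there is a linear functional $M$ on $L^\infty(G)$ with $\|M\|=M(1)=1$ and $M(L_x\varphi)=M(\varphi)$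 for all $x\in G$ and $\varphi\in L^\infty(G)$. -/

import Mathlib

open MeasureTheory Filter Topology
open scoped ENNReal

noncomputable section

/-! ### Projective tensor products and pseudo-amenable Banach algebras -/

section PseudoAmenable

universe u

variable (A : Type u) [NonUnitalNormedRing A] [NormedSpace ℂ A] [IsScalarTower ℂ A A]
  [SMulCommClass ℂ A A]

/-- The Banach space projective tensor product of `A` with itself: the completion of the
algebraic tensor product `A ⊗ A` (indexed by `Fin 2`) in the projective (semi)norm
`‖m‖ = inf {∑ j, ‖b j‖ * ‖c j‖ | m = ∑ j, b j ⊗ c j}`, which is the norm that Mathlib puts on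
`PiTensorProduct`. -/
abbrev ProjTensorSq : Type u :=
  UniformSpace.Completion (PiTensorProduct ℂ (fun _ : Fin 2 => A))

variable {A}

/-- The elementary tensor `b ⊗ c`. -/
def ProjTensorSq.tmul (b c : A) : ProjTensorSq A :=
  ((PiTensorProduct.tprod ℂ ![b, c] : PiTensorProduct ℂ (fun _ : Fin 2 => A)) :
    UniformSpace.Completion (PiTensorProduct ℂ (fun _ : Fin 2 => A)))

/-- The left action `m ↦ a · m`, determined by `a · (b ⊗ c) = (a * b) ⊗ c`. -/
def ProjTensorSq.leftAct (a : A) : ProjTensorSq A →L[ℂ] ProjTensorSq A :=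
  ContinuousLinearMap.completion
    (PiTensorProduct.mapL (E := fun _ : Fin 2 => A) (E' := fun _ : Fin 2 => A)
      ![ContinuousLinearMap.mul ℂ A a, ContinuousLinearMap.id ℂ A])

/-- The right action `m ↦ m · a`, determined by `(b ⊗ c) · a = b ⊗ (c * a)`. -/
def ProjTensorSq.rightAct (a : A) : ProjTensorSq A →L[ℂ] ProjTensorSq A :=
  ContinuousLinearMap.completion
    (PiTensorProduct.mapL (E := fun _ : Fin 2 => A) (E' := fun _ : Fin 2 => A)
      ![ContinuousLinearMap.id ℂ A, (ContinuousLinearMap.mul ℂ A).flip a])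

/-- Multiplication `(b, c) ↦ b * c` as a continuous multilinear map of two variables. -/
def mulMultilinear : ContinuousMultilinearMap ℂ (fun _ : Fin 2 => A) A :=
  MultilinearMap.mkContinuous
    { toFun := fun v => v 0 * v 1
      map_update_add' := by
        intro _ v i x y
        fin_cases i <;> simp [add_mul, mul_add]
      map_update_smul' := by
        intro _ v i c x
        fin_cases i <;> simp [smul_mul_assoc, mul_smul_comm] }
    1 (fun v => by simpa [Fin.prod_univ_two] using norm_mul_le (v 0) (v 1))

/-- The product map `π`, determined by `π (b ⊗ c) = b * c`. -/
def ProjTensorSq.prodMap [CompleteSpace A] : ProjTensorSq A →L[ℂ] A :=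
  ContinuousLinearMap.fromCompletion
    (PiTensorProduct.liftIsometry ℂ (fun _ : Fin 2 => A) A mulMultilinear)

theorem ProjTensorSq.leftAct_tmul (a b c : A) :
    leftAct a (tmul b c) = tmul (a * b) c := by
  simp only [leftAct, tmul, ContinuousLinearMap.completion_apply_coe, PiTensorProduct.mapL_apply,
    PiTensorProduct.map_tprod]
  congr 2
  ext i
  fin_cases i <;> simp

theorem ProjTensorSq.rightAct_tmul (a b c : A) :
    rightAct a (tmul b c) = tmul b (c * a) := by
  simp only [rightAct, tmul, ContinuousLinearMap.completion_apply_coe, PiTensorProduct.mapL_apply,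
    PiTensorProduct.map_tprod]
  congr 2
  ext i
  fin_cases i <;> simp

theorem ProjTensorSq.prodMap_tmul [CompleteSpace A] (b c : A) :
    prodMap (tmul b c) = b * c := by
  simp [prodMap, tmul, mulMultilinear]

variable (A) in
/-- A Banach algebra `A` is pseudo-amenable if it has a (not necessarily bounded) approximate
diagonal: a net `(m γ)` in the projective tensor product of `A` with itself such that
`a · m γ - m γ · a → 0` and `π (m γ) * a → a` for every `a` in `A`. -/
def IsPseudoAmenable [CompleteSpace A] : Prop :=
  ∃ (Γ : Type u) (_ : Preorder Γ) (_ : Nonempty Γ) (_ : IsDirected Γ (· ≤ ·))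
    (m : Γ → ProjTensorSq A), ∀ a : A,
      Tendsto (fun γ => ProjTensorSq.leftAct a (m γ) - ProjTensorSq.rightAct a (m γ))
        atTop (𝓝 0) ∧
      Tendsto (fun γ => ProjTensorSq.prodMap (m γ) * a) atTop (𝓝 a)

end PseudoAmenable

/-! ### The group algebra, Segal algebras and amenable groups -/

section Group

variable {G : Type*} [Group G] [TopologicalSpace G] [IsTopologicalGroup G]
  [MeasurableSpace G] [BorelSpace G] (μ : Measure G) [μ.IsMulLeftInvariant]

/-- Left translation `(L_x f)(y) = f (x⁻¹ y)` on `L^p(G)`. -/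
def leftTranslate (p : ℝ≥0∞) (x : G) : Lp ℂ p μ →ₗ[ℂ] Lp ℂ p μ :=
  Lp.compMeasurePreservingₗ ℂ (fun y => x⁻¹ * y) (measurePreserving_mul_left μ x⁻¹)

/-- Convolution on `L^1(G)`: `f * g = ∫ f(y) L_y g dy`, as an integral of `L^1(G)`-valued
functions, that is `(f * g)(x) = ∫ f(y) g(y⁻¹ x) dy`. (The vector-valued form avoids
representatives; the integrand is integrable for all `f` and `g` in `L^1(G)`, because `y ↦ L_y g`
is bounded and continuous and `f` is concentrated on a `σ`-compact set.) -/
def convL1 (f g : Lp ℂ 1 μ) : Lp ℂ 1 μ :=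
  ∫ y, f y • leftTranslate μ 1 y g ∂μ

variable {μ} in
/-- `IsSegalAlgebra ι` says that the injection `ι` exhibits the Banach algebra `S` as a Segal
algebra in `L^1(G)`: `S` stands for the subspace `range ι` with its own complete norm, and its
product is convolution. -/
structure IsSegalAlgebra {S : Type*} [NonUnitalNormedRing S] [NormedSpace ℂ S]
    (ι : S →L[ℂ] Lp ℂ 1 μ) : Prop where
  injective : Function.Injective ι
  map_mul : ∀ b c : S, ι (b * c) = convL1 μ (ι b) (ι c)
  /-- `S` is dense in `L^1(G)`. -/
  dense : DenseRange ι
  /-- `S` is a left ideal. -/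
  left_ideal : ∀ (f : Lp ℂ 1 μ) (b : S), ∃ c : S, ι c = convL1 μ f (ι b)
  /-- `S` is a contractive left `L^1(G)`-module. -/
  contractive : ∀ (f : Lp ℂ 1 μ) (b c : S), ι c = convL1 μ f (ι b) → ‖c‖ ≤ ‖f‖ * ‖b‖
  /-- `S` is an essential module: `L^1(G) * S` spans a dense subspace of `S`. -/
  essential : Dense (Submodule.span ℂ
    {c : S | ∃ (f : Lp ℂ 1 μ) (b : S), ι c = convL1 μ f (ι b)} : Set S)
  /-- `S` is closed under left translations. -/
  translate : ∀ (x : G) (b : S), ∃ c : S, ι c = leftTranslate μ 1 x (ι b)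

/-- The constant function `1` in `L^∞(G)`. -/
def oneLinfty : Lp ℂ ∞ μ := (memLp_top_const (1 : ℂ)).toLp (fun _ => (1 : ℂ))

/-- `G` is amenable: there is a left invariant mean on `L^∞(G)`, that is a functional `M` with
`‖M‖ = M 1 = 1` and `M (L_x φ) = M φ`. Here `L^∞(G)` is taken modulo locally null functions, as
usual for a general locally compact group: a functional on that quotient of `Lp ℂ ∞ μ` is one on
`Lp ℂ ∞ μ` that kills the functions vanishing almost everywhere on each compact set. (For inner
regular or `σ`-finite `μ` such functions are `0` and the condition is void.) -/
def IsAmenableGroup : Prop :=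
  ∃ M : Lp ℂ ∞ μ →L[ℂ] ℂ, ‖M‖ = 1 ∧ M (oneLinfty μ) = 1 ∧
    (∀ (x : G) (φ : Lp ℂ ∞ μ), M (leftTranslate μ ∞ x φ) = M φ) ∧
    (∀ φ : Lp ℂ ∞ μ, (∀ K : Set G, IsCompact K → φ =ᵐ[μ.restrict K] 0) → M φ = 0)

end Group

end

/-!
The augmentation `f ↦ ∫ f` is a character of `L¹(G)`; let `χ` be its restriction to `S`. Applying
the slice map `b ⊗ c ↦ χ c • b` to an approximate diagonal gives a net `(u)` in `S` with
`a * u - χ a • u → 0` for all `a` and `χ u → 1`. This net may be unbounded, so it need not be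
almost invariant under arbitrary elements of `L¹(G)`. However, if `χ a ≠ 0` then the translate
`L_x a` lies in `S`, satisfies `χ (L_x a) = χ a`, and `L_x (a * u) = (L_x a) * u`; hence
`v = a * u` satisfies `L_x v - v → 0`, while `‖v‖₁ ≥ |χ v| → |χ a| > 0`. A weak-* cluster point of
the means `φ ↦ ‖v‖⁻¹ ∫ |v| φ` on `L^∞(G)` is a left invariant mean.
-/

section SigmaCompactSupport

variable {X : Type*} [TopologicalSpace X] [R1Space X] [MeasurableSpace X] [BorelSpace X]
  {μ : Measure X} [μ.InnerRegularCompactLTTop]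

theorem exists_seq_isCompact_isClosed_measure_sdiff_eq_zero {s : Set X} (hs : MeasurableSet s)
    (hμs : μ s ≠ ∞) :
    ∃ K : ℕ → Set X, (∀ n, IsCompact (K n) ∧ IsClosed (K n)) ∧ μ (s \ ⋃ n, K n) = 0 := by
  have happrox (n : ℕ) : ∃ K ⊆ s, IsCompact K ∧ IsClosed K ∧ μ (s \ K) < (n : ℝ≥0∞)⁻¹ :=
    hs.exists_isCompact_isClosed_sdiff_lt hμs (ENNReal.inv_ne_zero.2 (ENNReal.natCast_ne_top n))
  choose K _ hKcompact hKclosed hK using happrox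
  refine ⟨K, fun n => ⟨hKcompact n, hKclosed n⟩, le_zero_iff.1 ?_⟩
  exact ge_of_tendsto' ENNReal.tendsto_inv_nat_nhds_zero fun n =>
    (measure_mono (Set.sdiff_subset_sdiff_right (Set.subset_iUnion K n))).trans (hK n).le

theorem exists_seq_isCompact_isClosed_ae_restrict_compl_eq_zero {E : Type*} [TopologicalSpace E]
    [T2Space E] [Zero E] {f : X → E} (hf : AEFinStronglyMeasurable f μ) :
    ∃ K : ℕ → Set X, (∀ n, IsCompact (K n) ∧ IsClosed (K n)) ∧
      f =ᵐ[μ.restrict (⋃ n, K n)ᶜ] 0 := by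
  obtain ⟨t, ht, hft, _⟩ := hf.exists_set_sigmaFinite
  let s : ℕ → Set X := fun n => spanningSets (μ.restrict t) n ∩ t
  have hs (n : ℕ) : MeasurableSet (s n) := (measurableSet_spanningSets _ n).inter ht
  have hμs (n : ℕ) : μ (s n) ≠ ∞ := by
    rw [← Measure.restrict_apply (measurableSet_spanningSets _ n)]
    exact (measure_spanningSets_lt_top _ n).ne
  choose K hK hsK using fun n => exists_seq_isCompact_isClosed_measure_sdiff_eq_zero (hs n) (hμs n)
  refine ⟨fun n => K n.unpair.1 n.unpair.2, fun n => hK _ _, ?_⟩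
  have hU : MeasurableSet (⋃ n : ℕ, K n.unpair.1 n.unpair.2) :=
    .iUnion fun n => (hK _ _).2.measurableSet
  have hsU : ∀ᵐ x ∂μ, ∀ n, x ∉ s n \ ⋃ m, K n m :=
    ae_all_iff.2 fun n => measure_eq_zero_iff_ae_notMem.1 (hsK n)
  refine (ae_restrict_iff' hU.compl).2 ?_
  filter_upwards [hsU, (ae_restrict_iff' ht.compl).1 hft] with x hxs hxt hxU
  refine hxt fun hx => ?_
  obtain ⟨n, hn⟩ := Set.mem_iUnion.1 ((iUnion_spanningSets (μ.restrict t)).ge (Set.mem_univ x))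
  refine hxs n ⟨⟨hn, hx⟩, fun hxK => hxU ?_⟩
  rw [Set.iUnion_unpair]
  exact Set.mem_iUnion_of_mem n hxK

variable {𝕜 E : Type*} [TopologicalSpace 𝕜] [T2Space 𝕜] [Zero 𝕜] [Zero E] [SMulWithZero 𝕜 E]

theorem aestronglyMeasurable_smul_of_continuous [TopologicalSpace E]
    [TopologicalSpace.PseudoMetrizableSpace E] [ContinuousSMul 𝕜 E] {f : X → 𝕜}
    (hf : AEFinStronglyMeasurable f μ) {F : X → E} (hF : Continuous F) :
    AEStronglyMeasurable (fun x => f x • F x) μ := by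
  have hfm : AEStronglyMeasurable f μ :=
    ⟨hf.mk f, hf.finStronglyMeasurable_mk.stronglyMeasurable, hf.ae_eq_mk⟩
  obtain ⟨K, hK, hfK⟩ := exists_seq_isCompact_isClosed_ae_restrict_compl_eq_zero hf
  have hFK : AEStronglyMeasurable F (μ.restrict (⋃ n, K n)) :=
    aestronglyMeasurable_iUnion_iff.2 fun n =>
      hF.continuousOn.aestronglyMeasurable_of_isCompact (hK n).1 (hK n).2.measurableSet
  have hzero : (fun x => f x • F x) =ᵐ[μ.restrict (⋃ n, K n)ᶜ] fun _ => 0 := by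
    filter_upwards [hfK] with x hx
    rw [hx, Pi.zero_apply, zero_smul]
  rw [← Measure.restrict_univ (μ := μ), ← Set.union_compl_self (⋃ n, K n),
    aestronglyMeasurable_union_iff]
  exact ⟨hfm.restrict.smul hFK, aestronglyMeasurable_const.congr hzero.symm⟩

theorem ae_smul_eq_zero_of_forall_isCompact {f : X → 𝕜} (hf : AEFinStronglyMeasurable f μ)
    {φ : X → E} (hφ : ∀ K : Set X, IsCompact K → φ =ᵐ[μ.restrict K] 0) :
    (fun x => f x • φ x) =ᵐ[μ] 0 := by
  obtain ⟨K, hK, hfK⟩ := exists_seq_isCompact_isClosed_ae_restrict_compl_eq_zero hf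
  have hφK : ∀ᵐ x ∂μ.restrict (⋃ n, K n), φ x = 0 :=
    (ae_restrict_iUnion_iff K _).2 fun n => hφ (K n) (hK n).1
  refine ae_of_ae_restrict_of_ae_restrict_compl (⋃ n, K n) ?_ ?_
  · filter_upwards [hφK] with x hx
    rw [hx, smul_zero, Pi.zero_apply]
  · filter_upwards [hfK] with x hx
    rw [hx, Pi.zero_apply, zero_smul, Pi.zero_apply]

end SigmaCompactSupport

section Augmentation

variable {X : Type*} [MeasurableSpace X] (μ : Measure X)

/-- The augmentation `f ↦ ∫ f` as a functional on `L¹`; for a Haar measure it is a character of the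
group algebra. -/
noncomputable def augmentation : Lp ℂ 1 μ →L[ℂ] ℂ := L1.integralCLM' ℂ

theorem augmentation_apply (f : Lp ℂ 1 μ) : augmentation μ f = ∫ x, f x ∂μ := by
  rw [← L1.integral_eq_integral, L1.integral_eq' ℂ, augmentation]

theorem norm_augmentation_le (f : Lp ℂ 1 μ) : ‖augmentation μ f‖ ≤ ‖f‖ := by
  rw [augmentation_apply, L1.norm_eq_integral_norm]
  exact norm_integral_le_integral_norm _

theorem augmentation_ne_zero [TopologicalSpace X] [OpensMeasurableSpace X] [Nonempty X]
    [IsLocallyFiniteMeasure μ] [μ.IsOpenPosMeasure] : augmentation μ ≠ 0 := by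
  obtain ⟨x⟩ := ‹Nonempty X›
  obtain ⟨U, hxU, hU, hμU⟩ := μ.exists_isOpen_measure_lt_top x
  have hpos : μ U ≠ 0 := hU.measure_ne_zero μ ⟨x, hxU⟩
  intro h
  have h0 := DFunLike.congr_fun h (indicatorConstLp 1 hU.measurableSet hμU.ne 1)
  rw [augmentation_apply, integral_indicatorConstLp, Complex.real_smul, mul_one, zero_apply,
    Complex.ofReal_eq_zero, measureReal_eq_zero_iff hμU.ne] at h0
  exact hpos h0

theorem exists_augmentation_ne_zero_of_denseRange [TopologicalSpace X] [OpensMeasurableSpace X]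
    [Nonempty X] [IsLocallyFiniteMeasure μ] [μ.IsOpenPosMeasure] {S : Type*} {ι : S → Lp ℂ 1 μ}
    (hι : DenseRange ι) : ∃ a, augmentation μ (ι a) ≠ 0 := by
  by_contra! h
  exact augmentation_ne_zero μ <| DFunLike.coe_injective <|
    hι.equalizer (augmentation μ).continuous continuous_const (funext h)

end Augmentation

section Translation

variable {G : Type*} [Group G] [TopologicalSpace G] [IsTopologicalGroup G]
  [MeasurableSpace G] [BorelSpace G] (μ : Measure G) [μ.IsMulLeftInvariant]

theorem coeFn_leftTranslate (p : ℝ≥0∞) (x : G) (f : Lp ℂ p μ) :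
    leftTranslate μ p x f =ᵐ[μ] fun y => f (x⁻¹ * y) :=
  Lp.coeFn_compMeasurePreserving f (measurePreserving_mul_left μ x⁻¹)

theorem norm_leftTranslate (p : ℝ≥0∞) (x : G) (f : Lp ℂ p μ) : ‖leftTranslate μ p x f‖ = ‖f‖ :=
  Lp.norm_compMeasurePreserving f (measurePreserving_mul_left μ x⁻¹)

theorem leftTranslate_mul (p : ℝ≥0∞) (x y : G) (f : Lp ℂ p μ) :
    leftTranslate μ p (x * y) f = leftTranslate μ p x (leftTranslate μ p y f) := by
  refine Lp.ext ?_
  have hxy := (measurePreserving_mul_left μ x⁻¹).quasiMeasurePreserving.ae_eq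
    (coeFn_leftTranslate μ p y f)
  filter_upwards [coeFn_leftTranslate μ p (x * y) f,
    coeFn_leftTranslate μ p x (leftTranslate μ p y f), hxy] with z h₁ h₂ h₃
  rw [h₁, h₂, mul_inv_rev, mul_assoc]
  exact h₃.symm

theorem continuous_leftTranslate [IsLocallyFiniteMeasure μ] [μ.InnerRegularCompactLTTop]
    {p : ℝ≥0∞} [Fact (1 ≤ p)] (hp : p ≠ ∞) (g : Lp ℂ p μ) :
    Continuous fun y => leftTranslate μ p y g := by
  let mulLeftInv : C(G, C(G, G)) :=
    (ContinuousMap.mk (fun a : G × G => a.1⁻¹ * a.2) (by fun_prop)).curry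
  exact continuous_const.compMeasurePreservingLp mulLeftInv.continuous
    (fun y => measurePreserving_mul_left μ y⁻¹) hp

theorem integrable_smul_leftTranslate [IsLocallyFiniteMeasure μ] [μ.InnerRegularCompactLTTop]
    {p : ℝ≥0∞} [Fact (1 ≤ p)] (hp : p ≠ ∞) {f : G → ℂ} (hf : Integrable f μ) (g : Lp ℂ p μ) :
    Integrable (fun y => f y • leftTranslate μ p y g) μ := by
  refine (hf.norm.mul_const ‖g‖).mono' (aestronglyMeasurable_smul_of_continuous
    hf.aefinStronglyMeasurable (continuous_leftTranslate μ hp g)) (.of_forall fun y => ?_)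
  rw [norm_smul, norm_leftTranslate]

theorem augmentation_leftTranslate (x : G) (f : Lp ℂ 1 μ) :
    augmentation μ (leftTranslate μ 1 x f) = augmentation μ f := by
  rw [augmentation_apply, augmentation_apply, integral_congr_ae (coeFn_leftTranslate μ 1 x f)]
  exact integral_mul_left_eq_self (fun y => f y) x⁻¹

theorem augmentation_convL1 [IsLocallyFiniteMeasure μ] [μ.InnerRegularCompactLTTop]
    (f g : Lp ℂ 1 μ) : augmentation μ (convL1 μ f g) = augmentation μ f * augmentation μ g := by
  have hint := integrable_smul_leftTranslate μ ENNReal.one_ne_top (L1.integrable_coeFn f) g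
  calc augmentation μ (convL1 μ f g)
      = ∫ y, augmentation μ (f y • leftTranslate μ 1 y g) ∂μ :=
        ((augmentation μ).integral_comp_comm hint).symm
    _ = ∫ y, f y * augmentation μ g ∂μ := by
        simp only [map_smul, augmentation_leftTranslate, smul_eq_mul]
    _ = augmentation μ f * augmentation μ g := by
        rw [integral_mul_const, ← augmentation_apply]

theorem convL1_leftTranslate (x : G) (f g : Lp ℂ 1 μ) :
    convL1 μ (leftTranslate μ 1 x f) g = leftTranslate μ 1 x (convL1 μ f g) := by
  let L : Lp ℂ 1 μ →ₗᵢ[ℂ] Lp ℂ 1 μ := ⟨leftTranslate μ 1 x, norm_leftTranslate μ 1 x⟩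
  calc convL1 μ (leftTranslate μ 1 x f) g
      = ∫ y, f (x⁻¹ * y) • leftTranslate μ 1 (x * (x⁻¹ * y)) g ∂μ := by
        refine integral_congr_ae ?_
        filter_upwards [coeFn_leftTranslate μ 1 x f] with y hy
        rw [hy, mul_inv_cancel_left]
    _ = ∫ y, f y • leftTranslate μ 1 (x * y) g ∂μ :=
        integral_mul_left_eq_self (fun y => f y • leftTranslate μ 1 (x * y) g) x⁻¹
    _ = ∫ y, L (f y • leftTranslate μ 1 y g) ∂μ := by
        simp only [leftTranslate_mul, map_smul]
        rfl
    _ = leftTranslate μ 1 x (convL1 μ f g) :=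
        L.integral_comp_comm fun y => f y • leftTranslate μ 1 y g

end Translation

section AbsoluteValue

variable {X : Type*} [MeasurableSpace X] {μ : Measure X} {p : ℝ≥0∞}

theorem lipschitzWith_ofReal_norm : LipschitzWith 1 fun z : ℂ => ((‖z‖ : ℝ) : ℂ) := by
  refine LipschitzWith.of_dist_le_mul fun z w => ?_
  rw [NNReal.coe_one, one_mul, Complex.dist_eq, Complex.dist_eq, ← Complex.ofReal_sub,
    Complex.norm_real]
  exact abs_norm_sub_norm_le z w

/-- The absolute value `|f|` of `f ∈ L^p`, still regarded as a complex-valued function. -/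
noncomputable def absLp (f : Lp ℂ p μ) : Lp ℂ p μ :=
  lipschitzWith_ofReal_norm.compLp (by simp) f

theorem coeFn_absLp (f : Lp ℂ p μ) : absLp f =ᵐ[μ] fun x => ((‖f x‖ : ℝ) : ℂ) :=
  lipschitzWith_ofReal_norm.coeFn_compLp (by simp) f

theorem norm_absLp_sub_le (f g : Lp ℂ p μ) : ‖absLp f - absLp g‖ ≤ ‖f - g‖ := by
  simpa only [absLp, NNReal.coe_one, one_mul] using
    lipschitzWith_ofReal_norm.norm_compLp_sub_le (by simp) f g

theorem norm_absLp_le (f : Lp ℂ p μ) : ‖absLp f‖ ≤ ‖f‖ := by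
  simpa only [absLp, NNReal.coe_one, one_mul] using
    lipschitzWith_ofReal_norm.norm_compLp_le (by simp) f

theorem augmentation_absLp (f : Lp ℂ 1 μ) : augmentation μ (absLp f) = ‖f‖ := by
  rw [augmentation_apply, L1.norm_eq_integral_norm, ← integral_complex_ofReal]
  exact integral_congr_ae (coeFn_absLp f)

theorem leftTranslate_absLp {G : Type*} [Group G] [TopologicalSpace G] [IsTopologicalGroup G]
    [MeasurableSpace G] [BorelSpace G] {μ : Measure G} [μ.IsMulLeftInvariant] (x : G)
    (f : Lp ℂ p μ) : leftTranslate μ p x (absLp f) = absLp (leftTranslate μ p x f) := by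
  refine Lp.ext ?_
  have habs := (measurePreserving_mul_left μ x⁻¹).quasiMeasurePreserving.ae_eq (coeFn_absLp f)
  filter_upwards [coeFn_leftTranslate μ p x (absLp f), coeFn_absLp (leftTranslate μ p x f),
    coeFn_leftTranslate μ p x f, habs] with y h₁ h₂ h₃ h₄
  rw [h₁, h₂, h₃]
  exact h₄

end AbsoluteValue

section Pairing

variable {X : Type*} [MeasurableSpace X] {μ : Measure X} {p q : ℝ≥0∞} [Fact (1 ≤ p)] [Fact (1 ≤ q)]
  [p.HolderConjugate q]

theorem norm_lpPairing_apply_le {𝕜 E F H : Type*} [RCLike 𝕜] [NormedAddCommGroup E]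
    [NormedSpace 𝕜 E] [NormedAddCommGroup F] [NormedSpace 𝕜 F] [NormedAddCommGroup H]
    [NormedSpace 𝕜 H] [NormedSpace ℝ H] [CompleteSpace H] (B : E →L[𝕜] F →L[𝕜] H) (f : Lp E p μ)
    (g : Lp F q μ) : ‖B.lpPairing μ p q f g‖ ≤ ‖B‖ * ‖f‖ * ‖g‖ := by
  rw [B.lpPairing_eq_integral, ← integral_congr_ae (B.coeFn_holder (r := 1) f g),
    ← L1.integral_eq_integral]
  exact (L1.norm_integral_le _).trans (B.norm_holder_apply_apply_le (r := 1) f g)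

variable (μ p q) in
/-- The pairing `(f, φ) ↦ ∫ f φ` of `L^p` and `L^q` for conjugate exponents. It is bilinear rather
than sesquilinear, so that it turns elements of `L^p` into functionals on `L^q`. -/
noncomputable def integralPairing : Lp ℂ p μ →L[ℂ] Lp ℂ q μ →L[ℂ] ℂ :=
  (ContinuousLinearMap.mul ℂ ℂ).lpPairing μ p q

theorem integralPairing_apply (f : Lp ℂ p μ) (φ : Lp ℂ q μ) :
    integralPairing μ p q f φ = ∫ x, f x * φ x ∂μ :=
  ContinuousLinearMap.lpPairing_eq_integral _ f φ

theorem norm_integralPairing_apply_le (f : Lp ℂ p μ) (φ : Lp ℂ q μ) :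
    ‖integralPairing μ p q f φ‖ ≤ ‖f‖ * ‖φ‖ := by
  simpa only [integralPairing, ContinuousLinearMap.opNorm_mul, one_mul] using
    norm_lpPairing_apply_le (ContinuousLinearMap.mul ℂ ℂ) f φ

theorem integralPairing_eq_zero_of_forall_isCompact [TopologicalSpace X] [R1Space X] [BorelSpace X]
    [μ.InnerRegularCompactLTTop] (hp : p ≠ ∞) (f : Lp ℂ p μ) {φ : Lp ℂ q μ}
    (hφ : ∀ K : Set X, IsCompact K → φ =ᵐ[μ.restrict K] 0) : integralPairing μ p q f φ = 0 := by
  have hp₀ : p ≠ 0 := (one_pos.trans_le (Fact.out : 1 ≤ p)).ne'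
  rw [integralPairing_apply]
  exact integral_eq_zero_of_ae <|
    ae_smul_eq_zero_of_forall_isCompact ((Lp.memLp f).aefinStronglyMeasurable hp₀ hp) hφ

theorem integralPairing_leftTranslate {G : Type*} [Group G] [TopologicalSpace G]
    [IsTopologicalGroup G] [MeasurableSpace G] [BorelSpace G] {μ : Measure G}
    [μ.IsMulLeftInvariant] (x : G) (f : Lp ℂ p μ) (φ : Lp ℂ q μ) :
    integralPairing μ p q f (leftTranslate μ q x φ)
      = integralPairing μ p q (leftTranslate μ p x⁻¹ f) φ := by
  have hf := (measurePreserving_mul_left μ x⁻¹).quasiMeasurePreserving.ae_eq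
    (coeFn_leftTranslate μ p x⁻¹ f)
  rw [integralPairing_apply, integralPairing_apply,
    ← integral_mul_left_eq_self (fun y => leftTranslate μ p x⁻¹ f y * φ y) x⁻¹]
  refine integral_congr_ae ?_
  filter_upwards [coeFn_leftTranslate μ q x φ, hf] with y hφy hfy
  simp only [Function.comp_apply, inv_inv, mul_inv_cancel_left] at hfy
  rw [hφy, hfy]

theorem coeFn_oneLinfty (μ : Measure X) : oneLinfty μ =ᵐ[μ] fun _ => (1 : ℂ) :=
  (memLp_top_const (1 : ℂ)).coeFn_toLp

theorem norm_oneLinfty_le (μ : Measure X) : ‖oneLinfty μ‖ ≤ 1 := by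
  rw [Lp.norm_def, eLpNorm_congr_ae (coeFn_oneLinfty μ), eLpNorm_exponent_top]
  exact ENNReal.toReal_le_of_le_ofReal zero_le_one
    (eLpNormEssSup_le_of_ae_bound (.of_forall fun _ => norm_one.le))

theorem integralPairing_oneLinfty (f : Lp ℂ 1 μ) :
    integralPairing μ 1 ∞ f (oneLinfty μ) = augmentation μ f := by
  rw [integralPairing_apply, augmentation_apply]
  refine integral_congr_ae ?_
  filter_upwards [coeFn_oneLinfty μ] with x hx
  rw [hx, mul_one]

end Pairing

section NormalizedMean

variable {X : Type*} [MeasurableSpace X] {μ : Measure X}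

/-- The mean `φ ↦ ‖v‖⁻¹ ∫ |v| φ` on `L^∞` attached to a nonzero `v ∈ L¹`; it is `0` for `v = 0`. -/
noncomputable def normalizedMean (v : Lp ℂ 1 μ) : Lp ℂ ∞ μ →L[ℂ] ℂ :=
  (‖v‖ : ℂ)⁻¹ • integralPairing μ 1 ∞ (absLp v)

theorem normalizedMean_apply (v : Lp ℂ 1 μ) (φ : Lp ℂ ∞ μ) :
    normalizedMean v φ = (‖v‖ : ℂ)⁻¹ * integralPairing μ 1 ∞ (absLp v) φ :=
  rfl

theorem norm_normalizedMean_le (v : Lp ℂ 1 μ) : ‖normalizedMean v‖ ≤ 1 := by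
  refine ContinuousLinearMap.opNorm_le_bound _ zero_le_one fun φ => ?_
  rw [normalizedMean_apply, norm_mul, norm_inv, Complex.norm_real, norm_norm]
  calc ‖v‖⁻¹ * ‖integralPairing μ 1 ∞ (absLp v) φ‖
      ≤ ‖v‖⁻¹ * (‖v‖ * ‖φ‖) := by
        gcongr
        exact (norm_integralPairing_apply_le _ φ).trans (by gcongr; exact norm_absLp_le v)
    _ = ‖v‖⁻¹ * ‖v‖ * ‖φ‖ := (mul_assoc _ _ _).symm
    _ ≤ 1 * ‖φ‖ := by
        gcongr
        exact inv_mul_le_one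

theorem normalizedMean_oneLinfty {v : Lp ℂ 1 μ} (hv : v ≠ 0) :
    normalizedMean v (oneLinfty μ) = 1 := by
  rw [normalizedMean_apply, integralPairing_oneLinfty, augmentation_absLp]
  exact inv_mul_cancel₀ (Complex.ofReal_ne_zero.2 (norm_ne_zero_iff.2 hv))

theorem norm_normalizedMean_leftTranslate_sub_le {G : Type*} [Group G] [TopologicalSpace G]
    [IsTopologicalGroup G] [MeasurableSpace G] [BorelSpace G] {μ : Measure G}
    [μ.IsMulLeftInvariant] (v : Lp ℂ 1 μ) (x : G) (φ : Lp ℂ ∞ μ) :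
    ‖normalizedMean v (leftTranslate μ ∞ x φ) - normalizedMean v φ‖
      ≤ ‖v‖⁻¹ * ‖leftTranslate μ 1 x⁻¹ v - v‖ * ‖φ‖ := by
  rw [normalizedMean_apply, normalizedMean_apply, integralPairing_leftTranslate,
    leftTranslate_absLp, ← mul_sub, ← sub_apply, ← map_sub, norm_mul, norm_inv, Complex.norm_real,
    norm_norm, mul_assoc]
  gcongr
  exact (norm_integralPairing_apply_le _ φ).trans (by gcongr; exact norm_absLp_sub_le _ v)

end NormalizedMean

theorem exists_norm_le_forall_tendsto_apply {𝕜 E Γ : Type*} [NontriviallyNormedField 𝕜]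
    [ProperSpace 𝕜] [SeminormedAddCommGroup E] [NormedSpace 𝕜 E] (U : Ultrafilter Γ)
    {N : Γ → StrongDual 𝕜 E} {r : ℝ} (hN : ∀ γ, ‖N γ‖ ≤ r) :
    ∃ M : StrongDual 𝕜 E, ‖M‖ ≤ r ∧ ∀ φ, Tendsto (fun γ => N γ φ) U (𝓝 (M φ)) := by
  have hball : ↑(U.map fun γ => StrongDual.toWeakDual (N γ)) ≤
      𝓟 (WeakDual.toStrongDual ⁻¹' Metric.closedBall (0 : StrongDual 𝕜 E) r) :=
    tendsto_principal.2 (.of_forall fun γ => mem_closedBall_zero_iff.2 (hN γ))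
  obtain ⟨M, hM, hlim⟩ :=
    (WeakDual.isCompact_closedBall (0 : StrongDual 𝕜 E) r).ultrafilter_le_nhds _ hball
  exact ⟨WeakDual.toStrongDual M, mem_closedBall_zero_iff.1 hM, fun φ =>
    ((WeakDual.eval_continuous φ).tendsto M).comp hlim⟩

section InvariantMean

variable {G : Type*} [Group G] [TopologicalSpace G] [IsTopologicalGroup G]
  [MeasurableSpace G] [BorelSpace G] {μ : Measure G} [μ.IsMulLeftInvariant]
  {Γ : Type*} {l : Filter Γ} [l.NeBot]

theorem isAmenableGroup_of_tendsto_functionals {N : Γ → Lp ℂ ∞ μ →L[ℂ] ℂ} (hN : ∀ γ, ‖N γ‖ ≤ 1)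
    (hone : Tendsto (fun γ => N γ (oneLinfty μ)) l (𝓝 1))
    (hinv : ∀ x φ, Tendsto (fun γ => N γ (leftTranslate μ ∞ x φ) - N γ φ) l (𝓝 0))
    (hnull : ∀ γ (φ : Lp ℂ ∞ μ), (∀ K : Set G, IsCompact K → φ =ᵐ[μ.restrict K] 0) → N γ φ = 0) :
    IsAmenableGroup μ := by
  have hU : (Ultrafilter.of l : Filter Γ) ≤ l := Ultrafilter.of_le l
  obtain ⟨M, hM, hlim⟩ := exists_norm_le_forall_tendsto_apply (Ultrafilter.of l) hN
  have hMone : M (oneLinfty μ) = 1 := tendsto_nhds_unique (hlim _) (hone.mono_left hU)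
  refine ⟨M, le_antisymm hM ?_, hMone, fun x φ => ?_, fun φ hφ => ?_⟩
  · simpa only [hMone, norm_one] using M.unit_le_opNorm _ (norm_oneLinfty_le μ)
  · exact sub_eq_zero.1 (tendsto_nhds_unique ((hlim _).sub (hlim φ)) ((hinv x φ).mono_left hU))
  · exact tendsto_nhds_unique (hlim φ) (tendsto_const_nhds.congr fun γ => (hnull γ φ hφ).symm)

variable [μ.InnerRegularCompactLTTop] {v : Γ → Lp ℂ 1 μ}

theorem isAmenableGroup_of_tendsto_norm_inv_mul (hv : ∀ᶠ γ in l, v γ ≠ 0)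
    (hinv : ∀ x, Tendsto (fun γ => ‖v γ‖⁻¹ * ‖leftTranslate μ 1 x (v γ) - v γ‖) l (𝓝 0)) :
    IsAmenableGroup μ := by
  refine isAmenableGroup_of_tendsto_functionals (l := l) (fun γ => norm_normalizedMean_le (v γ))
    ?_ (fun x φ => ?_) fun γ φ hφ => ?_
  · exact tendsto_const_nhds.congr' (hv.mono fun γ hγ => (normalizedMean_oneLinfty hγ).symm)
  · refine squeeze_zero_norm (fun γ => norm_normalizedMean_leftTranslate_sub_le (v γ) x φ) ?_
    simpa only [zero_mul] using (hinv x⁻¹).mul_const ‖φ‖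
  · rw [normalizedMean_apply,
      integralPairing_eq_zero_of_forall_isCompact ENNReal.one_ne_top _ hφ, mul_zero]

theorem isAmenableGroup_of_tendsto_augmentation {c : ℂ} (hc : c ≠ 0)
    (hv : Tendsto (fun γ => augmentation μ (v γ)) l (𝓝 c))
    (hinv : ∀ x, Tendsto (fun γ => leftTranslate μ 1 x (v γ) - v γ) l (𝓝 0)) :
    IsAmenableGroup μ := by
  have haug : ∀ᶠ γ in l, augmentation μ (v γ) ≠ 0 := hv.eventually_ne hc
  have hv₀ : ∀ᶠ γ in l, v γ ≠ 0 := haug.mono fun γ hγ hvγ => hγ (by rw [hvγ, map_zero])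
  refine isAmenableGroup_of_tendsto_norm_inv_mul hv₀ fun x => ?_
  have hlim : Tendsto
      (fun γ => ‖augmentation μ (v γ)‖⁻¹ * ‖leftTranslate μ 1 x (v γ) - v γ‖) l (𝓝 0) := by
    simpa only [norm_zero, mul_zero] using (hv.norm.inv₀ (norm_ne_zero_iff.2 hc)).mul (hinv x).norm
  refine squeeze_zero' (.of_forall fun γ => by positivity) ?_ hlim
  filter_upwards [haug] with γ hγ
  gcongr
  exact norm_augmentation_le μ (v γ)

end InvariantMean

section Slice

variable {A : Type*} [NonUnitalNormedRing A] [NormedSpace ℂ A]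

theorem ProjTensorSq.ext_tmul {E : Type*} [NormedAddCommGroup E] [NormedSpace ℂ E]
    {S T : ProjTensorSq A →L[ℂ] E} (h : ∀ b c : A, S (tmul b c) = T (tmul b c)) : S = T := by
  ext m
  induction m using UniformSpace.Completion.induction_on with
  | hp => exact isClosed_eq S.continuous T.continuous
  | ih m =>
    induction m using PiTensorProduct.induction_on with
    | smul_tprod r f =>
      have hf : f = ![f 0, f 1] := List.ofFn_inj.mp rfl
      rw [UniformSpace.Completion.coe_smul, map_smul, map_smul, hf]
      exact congrArg (r • ·) (h (f 0) (f 1))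
    | add x y hx hy => rw [UniformSpace.Completion.coe_add, map_add, map_add, hx, hy]

/-- The bilinear map `(b, c) ↦ χ c • b`, in the multilinear form from which maps on `ProjTensorSq`
are built. -/
noncomputable def sliceMultilinear (χ : A →L[ℂ] ℂ) :
    ContinuousMultilinearMap ℂ (fun _ : Fin 2 => A) A :=
  MultilinearMap.mkContinuous
    { toFun := fun v => χ (v 1) • v 0
      map_update_add' := by
        intro _ v i x y
        fin_cases i <;> simp [add_smul]
      map_update_smul' := by
        intro _ v i c x
        fin_cases i <;> simp [mul_smul, smul_comm c] }
    ‖χ‖ (fun v => by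
      simp only [MultilinearMap.coe_mk, norm_smul, Fin.prod_univ_two]
      calc ‖χ (v 1)‖ * ‖v 0‖ ≤ ‖χ‖ * ‖v 1‖ * ‖v 0‖ := by gcongr; exact χ.le_opNorm _
        _ = ‖χ‖ * (‖v 0‖ * ‖v 1‖) := by ring)

variable [CompleteSpace A]

/-- The slice map `id ⊗ χ`, determined by `b ⊗ c ↦ χ c • b`. -/
noncomputable def ProjTensorSq.slice (χ : A →L[ℂ] ℂ) : ProjTensorSq A →L[ℂ] A :=
  ContinuousLinearMap.fromCompletion
    (PiTensorProduct.liftIsometry ℂ (fun _ : Fin 2 => A) A (sliceMultilinear χ))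

theorem ProjTensorSq.slice_tmul (χ : A →L[ℂ] ℂ) (b c : A) : slice χ (tmul b c) = χ c • b := by
  simp [slice, tmul, sliceMultilinear]

variable [IsScalarTower ℂ A A] [SMulCommClass ℂ A A]

theorem ProjTensorSq.slice_leftAct (χ : A →L[ℂ] ℂ) (a : A) (m : ProjTensorSq A) :
    slice χ (leftAct a m) = a * slice χ m := by
  have h : (slice χ).comp (leftAct a) = (ContinuousLinearMap.mul ℂ A a).comp (slice χ) :=
    ext_tmul fun b c => by simp [leftAct_tmul, slice_tmul]
  exact DFunLike.congr_fun h m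

theorem ProjTensorSq.slice_rightAct {χ : A →L[ℂ] ℂ} (hχ : ∀ b c, χ (b * c) = χ b * χ c) (a : A)
    (m : ProjTensorSq A) : slice χ (rightAct a m) = χ a • slice χ m := by
  have h : (slice χ).comp (rightAct a) = χ a • slice χ :=
    ext_tmul fun b c => by simp [rightAct_tmul, slice_tmul, hχ, mul_smul, smul_comm (χ c)]
  exact DFunLike.congr_fun h m

theorem ProjTensorSq.apply_slice {χ : A →L[ℂ] ℂ} (hχ : ∀ b c, χ (b * c) = χ b * χ c)
    (m : ProjTensorSq A) : χ (slice χ m) = χ (prodMap m) := by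
  have h : χ.comp (slice χ) = χ.comp prodMap :=
    ext_tmul fun b c => by simp [prodMap_tmul, slice_tmul, hχ, mul_comm]
  exact DFunLike.congr_fun h m

theorem IsPseudoAmenable.exists_filter_tendsto_of_character (h : IsPseudoAmenable A)
    {χ : A →L[ℂ] ℂ} (hχ : ∀ b c, χ (b * c) = χ b * χ c) {a₀ : A} (ha₀ : χ a₀ ≠ 0) :
    ∃ l : Filter A, l.NeBot ∧ (∀ a, Tendsto (fun u => a * u - χ a • u) l (𝓝 0)) ∧
      Tendsto χ l (𝓝 1) := by
  obtain ⟨Γ, _, _, _, m, hm⟩ := h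
  refine ⟨map (fun γ => ProjTensorSq.slice χ (m γ)) atTop, inferInstance,
    fun a => tendsto_map'_iff.2 ?_, tendsto_map'_iff.2 ?_⟩
  · have hslice := ((ProjTensorSq.slice χ).continuous.tendsto 0).comp (hm a).1
    simpa only [Function.comp_def, map_sub, map_zero, ProjTensorSq.slice_leftAct,
      ProjTensorSq.slice_rightAct hχ] using hslice
  · have hprod := ((χ.continuous.tendsto a₀).comp (hm a₀).2).mul_const (χ a₀)⁻¹
    simpa only [Function.comp_def, hχ, ProjTensorSq.apply_slice hχ, mul_inv_cancel_right₀ ha₀,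
      mul_inv_cancel₀ ha₀] using hprod

end Slice

theorem mainTheorem2_general {G : Type*} [Group G] [TopologicalSpace G] [IsTopologicalGroup G]
    [MeasurableSpace G] [BorelSpace G] (μ : Measure G) [μ.IsMulLeftInvariant]
    [IsLocallyFiniteMeasure μ] [μ.InnerRegularCompactLTTop]
    {S : Type*} [NonUnitalNormedRing S] [NormedSpace ℂ S] [IsScalarTower ℂ S S]
    [SMulCommClass ℂ S S] [CompleteSpace S] (ι : S →L[ℂ] Lp ℂ 1 μ)
    (hmul : ∀ b c, ι (b * c) = convL1 μ (ι b) (ι c)) {a : S} (ha : augmentation μ (ι a) ≠ 0)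
    (htranslate : ∀ x, ∃ b, ι b = leftTranslate μ 1 x (ι a)) (h : IsPseudoAmenable S) :
    IsAmenableGroup μ := by
  let χ : S →L[ℂ] ℂ := (augmentation μ).comp ι
  have hχ (b c : S) : χ (b * c) = χ b * χ c := by
    simp only [χ, ContinuousLinearMap.comp_apply, hmul, augmentation_convL1]
  obtain ⟨l, _, hl, hl₁⟩ := h.exists_filter_tendsto_of_character hχ ha
  have hχau : Tendsto (fun u => χ (a * u)) l (𝓝 (χ a)) := by
    simpa only [hχ, mul_one] using hl₁.const_mul (χ a)
  refine isAmenableGroup_of_tendsto_augmentation (v := fun u => ι (a * u)) ha hχau fun x => ?_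
  obtain ⟨b, hb⟩ := htranslate x
  have hχb : χ b = χ a := by
    simp only [χ, ContinuousLinearMap.comp_apply, hb, augmentation_leftTranslate]
  have htr (u : S) : leftTranslate μ 1 x (ι (a * u)) = ι (b * u) := by
    rw [hmul, hmul, hb, convL1_leftTranslate]
  have hdiff : Tendsto (fun u => b * u - a * u) l (𝓝 0) := by
    simpa only [hχb, sub_sub_sub_cancel_right, sub_zero] using (hl b).sub (hl a)
  simpa only [htr, Function.comp_def, map_sub, map_zero] using
    (ι.continuous.tendsto 0).comp hdiff

theorem mainTheorem2 {G : Type*} [Group G] [TopologicalSpace G] [IsTopologicalGroup G]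
    [T2Space G] [LocallyCompactSpace G] [MeasurableSpace G] [BorelSpace G]
    (μ : Measure G) [μ.IsHaarMeasure] [μ.InnerRegularCompactLTTop]
    {S : Type*} [NonUnitalNormedRing S] [NormedSpace ℂ S] [IsScalarTower ℂ S S]
    [SMulCommClass ℂ S S] [CompleteSpace S]
    (ι : S →L[ℂ] Lp ℂ 1 μ) (hS : IsSegalAlgebra ι) (h : IsPseudoAmenable S) :
    IsAmenableGroup μ := by
  obtain ⟨a, ha⟩ := exists_augmentation_ne_zero_of_denseRange μ hS.dense
  exact mainTheorem2_general μ ι hS.map_mul ha (fun x => hS.translate x a) h
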